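/- Let $P$ be a finite poset with least element $\hat 0$ and greatest element $\hat 1$ that is graded with rank function $\rho$ (so $\rho(\hat 0)=0$ and $\rho(y)=\rho(x)+1$ whenever $y$ covers $x$). Suppose that $P$ is binomial, i.e. for every $k$ any two intervals $[x,y]$ and $[u,v]$ of $P$ with $\rho(y)-\rho(x)=\rho(v)-\rho(u)=k$ have the same number of maximal chains, and Eulerian, i.e. every interval $[x,y]$ with $x<y$ contains as many elements of even rank as elements of odd rank. If the rank $n=\rho(\hat 1)$ of $P$ is even and $n=2m\ge 4$, then $P$ is isomorphic either to the butterfly poset $T_n$ or to the boolean lattice $B_n$. Here $B_n$ is the set of all subsets of $\{1,\dots,n\}$ ordered by inclusion, and $T_n$ consists of a least element $\hat 0$, a greatest element $\hat 1$ and the elements $(k,i)$ with $1\le k\le n-1$ and $i\in\{1,2\}$, where $(k,i)<(l,j)$ if and only if $k<l$. -/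

import Mathlib

/-- The number of maximal chains of the interval `[x, y]` of a poset. -/
noncomputable def numMaximalChains {P : Type*} [PartialOrder P] (x y : P) : ℕ :=
  Nat.card (Flag (Set.Icc x y))

/-- `[x, y]` is an `n`-interval of the graded poset `P`: `x ≤ y` and `ρ(y) = ρ(x) + n`, where the
rank function `ρ` is `grade ℕ` (it increases by one along covers and vanishes at minimal
elements). -/
def IsIntervalOfRank {P : Type*} [PartialOrder P] [GradeMinOrder ℕ P] (n : ℕ) (x y : P) : Prop :=
  x ≤ y ∧ grade ℕ y = grade ℕ x + n

/-- A graded poset is binomial if, for every `n`, any two of its `n`-intervals have the same number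
of maximal chains. -/
def IsBinomialPoset (P : Type*) [PartialOrder P] [GradeMinOrder ℕ P] : Prop :=
  ∀ (n : ℕ) (x y u v : P), IsIntervalOfRank n x y → IsIntervalOfRank n u v →
    numMaximalChains x y = numMaximalChains u v

/-- A graded poset is Eulerian if every non-singleton interval `[x, y]` has as many elements of even
rank as elements of odd rank. -/
def IsEulerianPoset (P : Type*) [PartialOrder P] [GradeMinOrder ℕ P] : Prop :=
  ∀ x y : P, x < y →
    {z ∈ Set.Icc x y | Even (grade ℕ z)}.ncard = {z ∈ Set.Icc x y | Odd (grade ℕ z)}.ncard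

/-- The elements of the butterfly poset of rank `n` other than the least and the greatest one: two
elements on each of the `n - 1` levels. -/
@[ext]
structure ButterflyProper (n : ℕ) where
  level : Fin (n - 1)
  side : Fin 2

/-- Two distinct elements are comparable exactly when they are on different levels. -/
instance ButterflyProper.instPartialOrder (n : ℕ) : PartialOrder (ButterflyProper n) where
  le a b := a = b ∨ a.level < b.level
  le_refl a := Or.inl rfl
  le_trans a b c := by
    rintro (rfl | h₁) (rfl | h₂)
    · exact Or.inl rfl
    · exact Or.inr h₂
    · exact Or.inr h₁
    · exact Or.inr (h₁.trans h₂)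
  le_antisymm a b := by
    rintro (rfl | h₁) (h | h₂)
    · rfl
    · rfl
    · exact h.symm
    · exact absurd (h₁.trans h₂) (lt_irrefl _)

/-- The butterfly poset `T_n` of rank `n ≥ 1`: two elements on each rank `1, …, n - 1`, each of them
above everything on lower ranks, together with a least and a greatest element. -/
abbrev ButterflyPoset (n : ℕ) : Type := WithBot (WithTop (ButterflyProper n))

/-- The boolean lattice `B_n`: the subsets of an `n`-element set ordered by inclusion. -/
abbrev BooleanLattice (n : ℕ) : Type := Finset (Fin n)

/-!
In a binomial poset the size of level `j` of an interval of rank `k` is `b k / (b j * b (k - j))`,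
where `b` counts the maximal chains of an interval by its rank. The Euler relation gives `b 2 = 2`,
and at an even rank `2 * l + 4` it is one equation for the last two values of `b` in terms of the
earlier ones. Integrality of the ratios `b (k + 1) / b k`, which count atoms and hence increase with
`k`, leaves `b 3 = 4` or `b 3 = 6`, and in each case it singles out one continuation, except that
`b (k + 1) = 3 * b k` after `b j = 2 ^ (j - 1)` has to be excluded by a look at the atoms.

If `b k = 2 ^ (k - 1)`, every proper level has two elements, in `[⊥, ⊤]` and in each `[u, ⊤]`, so
elements of different levels are comparable. If `b k = k!`, the levels have the sizes of those of a
boolean lattice, and elements turn out to be ordered as their sets of atoms; then counting shows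
that every set of atoms occurs.
-/

open Finset

section MaximalChains

variable {P : Type*} [PartialOrder P] {x y z : P} {s : Set P}

/-- The maximal chains of `[x, y]` as sets of elements of the whole poset. Being a chain and being
maximal are encoded together: `s` consists of exactly those elements of `[x, y]` that are comparable
to every member of `s`. -/
def maximalChains (x y : P) : Set (Set P) :=
  {s | s ⊆ Set.Icc x y ∧ ∀ z ∈ Set.Icc x y, z ∈ s ↔ ∀ w ∈ s, z ≤ w ∨ w ≤ z}

/-- The maximal chains of the type `Set.Icc x y` correspond to those in `maximalChains x y`. -/
def flagEquivMaximalChains (x y : P) : Flag (Set.Icc x y) ≃ maximalChains x y where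
  toFun s := ⟨Subtype.val '' (s : Set (Set.Icc x y)), by
    refine ⟨by rintro _ ⟨z, -, rfl⟩; exact z.2, fun z hz => ?_⟩
    have hmem : z ∈ Subtype.val '' (s : Set (Set.Icc x y)) ↔ (⟨z, hz⟩ : Set.Icc x y) ∈ s := by
      simp [hz.1, hz.2]
    rw [hmem, Flag.mem_iff_forall_le_or_ge]
    exact (Set.forall_mem_image (p := fun w => z ≤ w ∨ w ≤ z)).symm⟩
  invFun t :=
    { carrier := Subtype.val ⁻¹' t.1
      Chain' := fun z hz w hw _ => ((t.2.2 z z.2).1 hz) w hw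
      max_chain' := fun s hs hts => hts.antisymm fun z hz =>
        (t.2.2 z z.2).2 fun w hw => hs.total hz (hts (a := ⟨w, t.2.1 hw⟩) hw) }
  left_inv s := Flag.ext (Set.preimage_image_eq _ Subtype.val_injective)
  right_inv t := Subtype.ext <| Set.image_preimage_eq_of_subset <| by
    rw [Subtype.range_coe]
    exact t.2.1

theorem numMaximalChains_eq_card (x y : P) :
    numMaximalChains x y = Nat.card (maximalChains x y) :=
  Nat.card_congr (flagEquivMaximalChains x y)

theorem le_or_le_of_mem_maximalChains (hs : s ∈ maximalChains x y) {v w : P} (hv : v ∈ s)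
    (hw : w ∈ s) : v ≤ w ∨ w ≤ v :=
  (hs.2 v (hs.1 hv)).1 hv w hw

theorem left_mem_of_mem_maximalChains (hxy : x ≤ y) (hs : s ∈ maximalChains x y) : x ∈ s :=
  (hs.2 x ⟨le_rfl, hxy⟩).2 fun _ hw => Or.inl (hs.1 hw).1

theorem right_mem_of_mem_maximalChains (hxy : x ≤ y) (hs : s ∈ maximalChains x y) : y ∈ s :=
  (hs.2 y ⟨hxy, le_rfl⟩).2 fun _ hw => Or.inr (hs.1 hw).2

theorem inter_Iic_mem_maximalChains (hs : s ∈ maximalChains x y) (hz : z ∈ s) :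
    s ∩ Set.Iic z ∈ maximalChains x z := by
  refine ⟨fun w hw => ⟨(hs.1 hw.1).1, hw.2⟩, fun w hw => ⟨fun h v hv => ?_, fun h => ⟨?_, hw.2⟩⟩⟩
  · exact le_or_le_of_mem_maximalChains hs h.1 hv.1
  · refine (hs.2 w ⟨hw.1, hw.2.trans (hs.1 hz).2⟩).2 fun v hv => ?_
    rcases le_or_le_of_mem_maximalChains hs hv hz with hvz | hzv
    · exact h v ⟨hv, hvz⟩
    · exact Or.inl (hw.2.trans hzv)

theorem inter_Ici_mem_maximalChains (hs : s ∈ maximalChains x y) (hz : z ∈ s) :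
    s ∩ Set.Ici z ∈ maximalChains z y := by
  refine ⟨fun w hw => ⟨hw.2, (hs.1 hw.1).2⟩, fun w hw => ⟨fun h v hv => ?_, fun h => ⟨?_, hw.1⟩⟩⟩
  · exact le_or_le_of_mem_maximalChains hs h.1 hv.1
  · refine (hs.2 w ⟨(hs.1 hz).1.trans hw.1, hw.2⟩).2 fun v hv => ?_
    rcases le_or_le_of_mem_maximalChains hs hv hz with hvz | hzv
    · exact Or.inr (hvz.trans hw.1)
    · exact h v ⟨hv, hzv⟩

theorem union_mem_maximalChains (hxz : x ≤ z) (hzy : z ≤ y) {t u : Set P}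
    (ht : t ∈ maximalChains x z) (hu : u ∈ maximalChains z y) :
    t ∪ u ∈ maximalChains x y := by
  have hle : ∀ v ∈ t, ∀ w ∈ u, v ≤ w := fun v hv w hw => (ht.1 hv).2.trans (hu.1 hw).1
  refine ⟨Set.union_subset (ht.1.trans (Set.Icc_subset_Icc_right hzy))
    (hu.1.trans (Set.Icc_subset_Icc_left hxz)), fun w hw => ⟨?_, fun h => ?_⟩⟩
  · rintro (hwt | hwu) v (hvt | hvu)
    · exact le_or_le_of_mem_maximalChains ht hwt hvt
    · exact Or.inl (hle w hwt v hvu)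
    · exact Or.inr (hle v hvt w hwu)
    · exact le_or_le_of_mem_maximalChains hu hwu hvu
  · rcases h z (Or.inl (right_mem_of_mem_maximalChains hxz ht)) with hwz | hzw
    · exact Or.inl ((ht.2 w ⟨hw.1, hwz⟩).2 fun v hv => h v (Or.inl hv))
    · exact Or.inr ((hu.2 w ⟨hzw, hw.2⟩).2 fun v hv => h v (Or.inr hv))

/-- Cutting the maximal chains of `[x, y]` that pass through `z` at `z`. -/
def maximalChainsThroughEquiv (hxz : x ≤ z) (hzy : z ≤ y) :
    {s // s ∈ maximalChains x y ∧ z ∈ s} ≃ maximalChains x z × maximalChains z y where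
  toFun s := (⟨_, inter_Iic_mem_maximalChains s.2.1 s.2.2⟩,
    ⟨_, inter_Ici_mem_maximalChains s.2.1 s.2.2⟩)
  invFun p := ⟨p.1 ∪ p.2, union_mem_maximalChains hxz hzy p.1.2 p.2.2,
    Or.inl (right_mem_of_mem_maximalChains hxz p.1.2)⟩
  left_inv s := Subtype.ext <| by
    change s.1 ∩ Set.Iic z ∪ s.1 ∩ Set.Ici z = s.1
    rw [← Set.inter_union_distrib_left, Set.inter_eq_left]
    exact fun w hw => le_or_le_of_mem_maximalChains s.2.1 hw s.2.2
  right_inv := by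
    rintro ⟨⟨t, ht⟩, u, hu⟩
    have hzt := right_mem_of_mem_maximalChains hxz ht
    have hzu := left_mem_of_mem_maximalChains hzy hu
    refine Prod.ext (Subtype.ext (Set.Subset.antisymm ?_ ?_))
      (Subtype.ext (Set.Subset.antisymm ?_ ?_))
    · rintro w ⟨hwt | hwu, hwz⟩
      · exact hwt
      · rwa [le_antisymm hwz (hu.1 hwu).1]
    · exact fun w hw => ⟨Or.inl hw, (ht.1 hw).2⟩
    · rintro w ⟨hwt | hwu, hzw⟩
      · rwa [le_antisymm (ht.1 hwt).2 hzw]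
      · exact hwu
    · exact fun w hw => ⟨Or.inr hw, (hu.1 hw).1⟩

theorem card_maximalChains_through (hxz : x ≤ z) (hzy : z ≤ y) :
    Nat.card {s // s ∈ maximalChains x y ∧ z ∈ s} =
      numMaximalChains x z * numMaximalChains z y := by
  rw [Nat.card_congr (maximalChainsThroughEquiv hxz hzy), Nat.card_prod,
    numMaximalChains_eq_card, numMaximalChains_eq_card]

theorem numMaximalChains_eq_one_of_isChain (h : IsChain (· ≤ ·) (Set.Icc x y)) :
    numMaximalChains x y = 1 := by
  have huniq : ∀ s : Flag (Set.Icc x y), (s : Set (Set.Icc x y)) = Set.univ := fun s =>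
    Set.eq_univ_of_forall fun z => Flag.mem_iff_forall_le_or_ge.2 fun w _ => h.total z.2 w.2
  obtain ⟨s⟩ : Nonempty (Flag (Set.Icc x y)) := inferInstance
  exact Nat.card_eq_one_iff_unique.2
    ⟨⟨fun s t => Flag.ext ((huniq s).trans (huniq t).symm)⟩, ⟨s⟩⟩

variable [LocallyFiniteOrder P]

instance finite_maximalChains (x y : P) : Finite (maximalChains x y) :=
  ((Set.finite_Icc x y).finite_subsets.subset fun _ hs => hs.1).to_subtype

theorem numMaximalChains_pos (x y : P) : 0 < numMaximalChains x y := by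
  have : Finite (Flag (Set.Icc x y)) := Finite.of_equiv _ (flagEquivMaximalChains x y).symm
  exact Nat.card_pos

theorem exists_covBy_of_mem_maximalChains (hs : s ∈ maximalChains x y) (hz : z ∈ s)
    (hzy : z < y) : ∃ w ∈ s, z ⋖ w := by
  have hys := right_mem_of_mem_maximalChains ((hs.1 hz).1.trans hzy.le) hs
  have hfin : {v ∈ s | z < v}.Finite := (Set.finite_Icc x y).subset fun v hv => hs.1 hv.1
  obtain ⟨w, hw⟩ := hfin.exists_minimal ⟨y, hys, hzy⟩
  obtain ⟨hws, hzw⟩ := hw.prop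
  refine ⟨w, hws, hzw, fun c hzc hcw => hw.not_lt ⟨?_, hzc⟩ hcw⟩
  refine (hs.2 c ⟨(hs.1 hz).1.trans hzc.le, hcw.le.trans (hs.1 hws).2⟩).2 fun v hv => ?_
  rcases le_or_le_of_mem_maximalChains hs hv hz with hvz | hzv
  · exact Or.inr (hvz.trans hzc.le)
  rcases hzv.eq_or_lt with rfl | hzv
  · exact Or.inr hzc.le
  rcases le_or_le_of_mem_maximalChains hs hv hws with hvw | hwv
  · exact Or.inl (hcw.le.trans (hw.le_of_le ⟨hv, hzv⟩ hvw))
  · exact Or.inl (hcw.le.trans hwv)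

end MaximalChains

section Levels

variable {P : Type*} [PartialOrder P] [GradeMinOrder ℕ P] {x y z : P} {j k : ℕ}

theorem eq_of_le_of_grade_le (h : x ≤ y) (hg : grade ℕ y ≤ grade ℕ x) : x = y :=
  h.eq_of_not_lt fun hlt => (grade_strictMono (𝕆 := ℕ) hlt).not_ge hg

theorem isIntervalOfRank_zero (x : P) : IsIntervalOfRank 0 x x := ⟨le_rfl, rfl⟩

variable [LocallyFiniteOrder P]

/-- The elements of rank `j` of the interval `[x, y]`, with ranks counted from `x`. In particular
`intervalLevel x y 1` is the set of atoms of `[x, y]`. -/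
def intervalLevel (x y : P) (j : ℕ) : Finset P :=
  {z ∈ Finset.Icc x y | grade ℕ z = grade ℕ x + j}

theorem mem_intervalLevel : z ∈ intervalLevel x y j ↔ IsIntervalOfRank j x z ∧ z ≤ y := by
  rw [intervalLevel, mem_filter, mem_Icc, and_right_comm, IsIntervalOfRank]

theorem exists_mem_intervalLevel (hz : z ∈ Set.Icc x y) : ∃ j, z ∈ intervalLevel x y j :=
  ⟨grade ℕ z - grade ℕ x,
    mem_intervalLevel.2 ⟨⟨hz.1, (Nat.add_sub_of_le (grade_mono hz.1)).symm⟩, hz.2⟩⟩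

theorem intervalLevel_subset {y' : P} (h : y ≤ y') : intervalLevel x y j ⊆ intervalLevel x y' j :=
  fun _ hz => mem_intervalLevel.2
    ⟨(mem_intervalLevel.1 hz).1, (mem_intervalLevel.1 hz).2.trans h⟩

theorem isIntervalOfRank_sub_of_mem_intervalLevel (hxy : IsIntervalOfRank k x y)
    (hz : z ∈ intervalLevel x y j) : IsIntervalOfRank (k - j) z y := by
  obtain ⟨⟨-, hxz⟩, hzy⟩ := mem_intervalLevel.1 hz
  have := hxy.2
  have := grade_mono (𝕆 := ℕ) hzy
  exact ⟨hzy, by omega⟩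

theorem le_of_mem_intervalLevel (hxy : IsIntervalOfRank k x y) (hz : z ∈ intervalLevel x y j) :
    j ≤ k := by
  obtain ⟨⟨-, hxz⟩, hzy⟩ := mem_intervalLevel.1 hz
  have := hxy.2
  have := grade_mono (𝕆 := ℕ) hzy
  omega

theorem mem_Ioo_of_mem_intervalLevel (hxy : IsIntervalOfRank k x y) (hz : z ∈ intervalLevel x y j)
    (hj : 0 < j) (hjk : j < k) : z ∈ Set.Ioo x y := by
  obtain ⟨⟨hxz, hgz⟩, hzy⟩ := mem_intervalLevel.1 hz
  have := hxy.2
  refine ⟨hxz.lt_of_ne ?_, hzy.lt_of_ne ?_⟩ <;>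
  · rintro rfl
    omega

theorem sum_Icc_eq_sum_intervalLevel {M : Type*} [AddCommMonoid M]
    (hxy : IsIntervalOfRank k x y) (f : P → M) :
    ∑ z ∈ Finset.Icc x y, f z = ∑ j ∈ range (k + 1), ∑ z ∈ intervalLevel x y j, f z := by
  have hmaps : ∀ z ∈ Finset.Icc x y, grade ℕ z - grade ℕ x ∈ range (k + 1) := fun z hz => by
    have := grade_mono (𝕆 := ℕ) (mem_Icc.1 hz).2
    have := hxy.2
    exact mem_range.2 (by omega)
  rw [← sum_fiberwise_of_maps_to hmaps]
  refine sum_congr rfl fun j _ => sum_congr (filter_congr fun z hz => ?_) fun _ _ => rfl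
  have := grade_mono (𝕆 := ℕ) (mem_Icc.1 hz).1
  omega

theorem exists_mem_intervalLevel_of_mem_maximalChains {s : Set P} (hs : s ∈ maximalChains x y)
    (hxy : IsIntervalOfRank k x y) (hj : j ≤ k) : ∃ z ∈ intervalLevel x y j, z ∈ s := by
  induction j with
  | zero =>
    exact ⟨x, mem_intervalLevel.2 ⟨isIntervalOfRank_zero x, hxy.1⟩,
      left_mem_of_mem_maximalChains hxy.1 hs⟩
  | succ j ih =>
    obtain ⟨z, hz, hzs⟩ := ih (by omega)
    obtain ⟨⟨hxz, hgz⟩, hzy⟩ := mem_intervalLevel.1 hz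
    have hne : z ≠ y := by
      rintro rfl
      have := hxy.2
      omega
    obtain ⟨w, hws, hzw⟩ := exists_covBy_of_mem_maximalChains hs hzs (hzy.lt_of_ne hne)
    have hgw : grade ℕ z + 1 = grade ℕ w := Order.covBy_iff_add_one_eq.1 (hzw.grade ℕ)
    exact ⟨w, mem_intervalLevel.2 ⟨⟨hxz.trans hzw.le, by omega⟩, (hs.1 hws).2⟩, hws⟩

theorem eq_of_mem_intervalLevel_of_mem_maximalChains {s : Set P} (hs : s ∈ maximalChains x y)
    {w : P} (hz : z ∈ intervalLevel x y j) (hzs : z ∈ s) (hw : w ∈ intervalLevel x y j)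
    (hws : w ∈ s) : z = w := by
  have hg : grade ℕ z = grade ℕ w :=
    (mem_intervalLevel.1 hz).1.2.trans (mem_intervalLevel.1 hw).1.2.symm
  rcases le_or_le_of_mem_maximalChains hs hzs hws with h | h
  · exact eq_of_le_of_grade_le h hg.ge
  · exact (eq_of_le_of_grade_le h hg.le).symm

theorem numMaximalChains_eq_sum_intervalLevel (hxy : IsIntervalOfRank k x y) (hj : j ≤ k) :
    numMaximalChains x y =
      ∑ z ∈ intervalLevel x y j, numMaximalChains x z * numMaximalChains z y := by
  have hfin (z : P) : Finite {s // s ∈ maximalChains x y ∧ z ∈ s} :=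
    Finite.of_injective (β := maximalChains x y) (fun s => ⟨s.1, s.2.1⟩) fun _ _ h =>
      Subtype.ext (Subtype.mk.inj h)
  let forget : (Σ z : intervalLevel x y j, {s // s ∈ maximalChains x y ∧ z.1 ∈ s}) →
      maximalChains x y := fun p => ⟨p.2.1, p.2.2.1⟩
  have hforget : Function.Bijective forget := by
    refine ⟨?_, fun s => ?_⟩
    · rintro ⟨⟨z, hz⟩, s, hs, hzs⟩ ⟨⟨w, hw⟩, t, ht, hwt⟩ h
      obtain rfl : s = t := congrArg Subtype.val h
      obtain rfl := eq_of_mem_intervalLevel_of_mem_maximalChains hs hz hzs hw hwt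
      rfl
    · obtain ⟨z, hz, hzs⟩ := exists_mem_intervalLevel_of_mem_maximalChains s.2 hxy hj
      exact ⟨⟨⟨z, hz⟩, s, s.2, hzs⟩, rfl⟩
  rw [numMaximalChains_eq_card, ← Nat.card_eq_of_bijective forget hforget, Nat.card_sigma,
    ← sum_coe_sort (intervalLevel x y j)]
  exact sum_congr rfl fun z _ => card_maximalChains_through
    (mem_intervalLevel.1 z.2).1.1 (mem_intervalLevel.1 z.2).2

theorem IsEulerianPoset.sum_card_intervalLevel (hE : IsEulerianPoset P)
    (hxy : IsIntervalOfRank k x y) (hk : k ≠ 0) :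
    ∑ j ∈ range (k + 1), (-1 : ℤ) ^ j * #(intervalLevel x y j) = 0 := by
  have hlt : x < y := hxy.1.lt_of_ne fun h => hk (by simpa [h] using hxy.2)
  have hIcc : ∑ z ∈ Finset.Icc x y, (-1 : ℤ) ^ grade ℕ z = 0 := by
    have hcard := hE x y hlt
    simp only [← coe_Icc, ← coe_filter, Set.ncard_coe_finset, mem_coe] at hcard
    simp only [neg_one_pow_eq_ite, sum_ite, sum_const, Nat.not_even_iff_odd, hcard]
    simp
  have hfactor : ∑ z ∈ Finset.Icc x y, (-1 : ℤ) ^ grade ℕ z =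
      (-1) ^ grade ℕ x * ∑ j ∈ range (k + 1), (-1 : ℤ) ^ j * #(intervalLevel x y j) := by
    rw [sum_Icc_eq_sum_intervalLevel hxy, mul_sum]
    refine sum_congr rfl fun j _ => ?_
    have hval : ∀ z ∈ intervalLevel x y j, (-1 : ℤ) ^ grade ℕ z = (-1) ^ grade ℕ x * (-1) ^ j :=
      fun z hz => by rw [(mem_intervalLevel.1 hz).1.2, pow_add]
    rw [sum_congr rfl hval, sum_const, nsmul_eq_mul]
    ring
  exact (mul_eq_zero.1 (hfactor.symm.trans hIcc)).resolve_left (pow_ne_zero _ (by norm_num))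

end Levels

/-- `b` is the factorial function of `P`: all intervals of rank `k` have exactly `b k` maximal
chains. -/
def IsFactorialFunction (P : Type*) [PartialOrder P] [GradeMinOrder ℕ P] (b : ℕ → ℕ) : Prop :=
  ∀ (k : ℕ) (x y : P), IsIntervalOfRank k x y → numMaximalChains x y = b k

/-- The alternating sum of the level sizes of an interval of rank `n` in a poset with factorial
function `b`, divided by `b n`. -/
def eulerSum (b : ℕ → ℕ) (n : ℕ) : ℚ :=
  ∑ j ∈ range (n + 1), (-1) ^ j / (b j * b (n - j) : ℚ)

section FactorialFunction

variable {P : Type*} [PartialOrder P] [GradeMinOrder ℕ P]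

theorem IsBinomialPoset.exists_isFactorialFunction (hB : IsBinomialPoset P) :
    ∃ b, IsFactorialFunction P b := by
  classical
  refine ⟨fun k => if h : ∃ p : P × P, IsIntervalOfRank k p.1 p.2 then
    numMaximalChains h.choose.1 h.choose.2 else 0, fun k x y hxy => ?_⟩
  have h : ∃ p : P × P, IsIntervalOfRank k p.1 p.2 := ⟨(x, y), hxy⟩
  simp only [dif_pos h]
  exact hB k _ _ _ _ hxy h.choose_spec

namespace IsFactorialFunction

variable {x y : P} {b : ℕ → ℕ} {j k : ℕ}

theorem map_zero (hb : IsFactorialFunction P b) (x : P) : b 0 = 1 := by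
  rw [← hb 0 x x (isIntervalOfRank_zero x)]
  refine numMaximalChains_eq_one_of_isChain ?_
  rw [Set.Icc_self]
  exact IsChain.singleton

theorem map_one (hb : IsFactorialFunction P b) (hxy : IsIntervalOfRank 1 x y) : b 1 = 1 := by
  rw [← hb 1 x y hxy]
  refine numMaximalChains_eq_one_of_isChain ?_
  have hcov : x ⋖ y := by
    refine (covBy_iff_lt_covBy_grade (𝕆 := ℕ)).2
      ⟨hxy.1.lt_of_ne ?_, Order.covBy_iff_add_one_eq.2 hxy.2.symm⟩
    rintro rfl
    have := hxy.2
    omega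
  rw [hcov.Icc_eq]
  exact IsChain.pair hxy.1

variable [LocallyFiniteOrder P]

theorem pos (hb : IsFactorialFunction P b) (hxy : IsIntervalOfRank k x y) : 0 < b k :=
  hb k x y hxy ▸ numMaximalChains_pos x y

theorem card_intervalLevel_mul (hb : IsFactorialFunction P b) (hxy : IsIntervalOfRank k x y)
    (hj : j ≤ k) : #(intervalLevel x y j) * (b j * b (k - j)) = b k := by
  have hterm : ∀ z ∈ intervalLevel x y j,
      numMaximalChains x z * numMaximalChains z y = b j * b (k - j) := fun z hz => by
    rw [hb j x z (mem_intervalLevel.1 hz).1,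
      hb (k - j) z y (isIntervalOfRank_sub_of_mem_intervalLevel hxy hz)]
  rw [← hb k x y hxy, numMaximalChains_eq_sum_intervalLevel hxy hj, sum_congr rfl hterm,
    sum_const, smul_eq_mul]

theorem intervalLevel_nonempty (hb : IsFactorialFunction P b) (hxy : IsIntervalOfRank k x y)
    (hj : j ≤ k) : (intervalLevel x y j).Nonempty := by
  have h := hb.card_intervalLevel_mul hxy hj
  exact card_pos.1 (Nat.pos_of_mul_pos_right (h ▸ hb.pos hxy))

theorem pos_of_le (hb : IsFactorialFunction P b) (hxy : IsIntervalOfRank k x y) (hj : j ≤ k) :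
    0 < b j := by
  obtain ⟨z, hz⟩ := hb.intervalLevel_nonempty hxy hj
  exact hb.pos (mem_intervalLevel.1 hz).1

theorem map_one_of_pos (hb : IsFactorialFunction P b) (hxy : IsIntervalOfRank k x y)
    (hk : 0 < k) : b 1 = 1 := by
  obtain ⟨z, hz⟩ := hb.intervalLevel_nonempty hxy hk
  exact hb.map_one (mem_intervalLevel.1 hz).1

theorem map_succ (hb : IsFactorialFunction P b) (hxy : IsIntervalOfRank (k + 1) x y) :
    b (k + 1) = #(intervalLevel x y 1) * b k := by
  have h := hb.card_intervalLevel_mul hxy (Nat.le_add_left 1 k)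
  rwa [hb.map_one_of_pos hxy k.succ_pos, one_mul, Nat.add_sub_cancel, eq_comm] at h

theorem exists_ratio (hb : IsFactorialFunction P b) (hxy : IsIntervalOfRank k x y) (hj : j < k) :
    ∃ c, b (j + 1) = c * b j := by
  obtain ⟨z, hz⟩ := hb.intervalLevel_nonempty hxy hj
  exact ⟨_, hb.map_succ (mem_intervalLevel.1 hz).1⟩

theorem card_intervalLevel_one (hb : IsFactorialFunction P b)
    (hxy : IsIntervalOfRank (k + 1) x y) {c : ℕ} (hc : b (k + 1) = c * b k) :
    #(intervalLevel x y 1) = c :=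
  Nat.eq_of_mul_eq_mul_right (hb.pos_of_le hxy k.le_succ) ((hb.map_succ hxy).symm.trans hc)

theorem ratio_mono (hb : IsFactorialFunction P b) (hxy : IsIntervalOfRank (k + 2) x y) {c d : ℕ}
    (hc : b (k + 1) = c * b k) (hd : b (k + 2) = d * b (k + 1)) : c ≤ d := by
  obtain ⟨z, hz⟩ := hb.intervalLevel_nonempty hxy (Nat.le_succ (k + 1))
  obtain ⟨hxz, hzy⟩ := mem_intervalLevel.1 hz
  rw [← hb.card_intervalLevel_one hxz hc, ← hb.card_intervalLevel_one hxy hd]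
  exact card_le_card (intervalLevel_subset hzy)

theorem eulerSum_eq_zero (hb : IsFactorialFunction P b) (hE : IsEulerianPoset P)
    (hxy : IsIntervalOfRank k x y) (hk : k ≠ 0) : eulerSum b k = 0 := by
  have hne : (b k : ℚ) ≠ 0 := by exact_mod_cast (hb.pos hxy).ne'
  have hterm : ∀ j ∈ range (k + 1), (-1 : ℚ) ^ j / (b j * b (k - j)) =
      (-1 : ℚ) ^ j * #(intervalLevel x y j) / b k := fun j hj => by
    have hj := Nat.lt_succ_iff.1 (mem_range.1 hj)
    have hcard : (#(intervalLevel x y j) * (b j * b (k - j)) : ℚ) = b k := by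
      exact_mod_cast hb.card_intervalLevel_mul hxy hj
    have hj_pos : (b j : ℚ) ≠ 0 := by exact_mod_cast (hb.pos_of_le hxy hj).ne'
    have hkj_pos : (b (k - j) : ℚ) ≠ 0 := by exact_mod_cast (hb.pos_of_le hxy (k.sub_le j)).ne'
    rw [div_eq_div_iff (mul_ne_zero hj_pos hkj_pos) hne, ← hcard, mul_assoc]
  have hsum : (∑ j ∈ range (k + 1), (-1 : ℚ) ^ j * #(intervalLevel x y j)) = 0 := by
    exact_mod_cast hE.sum_card_intervalLevel hxy hk
  rw [eulerSum, sum_congr rfl hterm, ← sum_div, hsum, zero_div]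

end IsFactorialFunction

end FactorialFunction

section EulerSum

variable {f g : ℕ → ℕ} {l : ℕ}

theorem eulerSum_factorial {n : ℕ} (hn : n ≠ 0) : eulerSum Nat.factorial n = 0 := by
  have hterm : ∀ j ∈ range (n + 1), (-1 : ℚ) ^ j / (j.factorial * (n - j).factorial) =
      (-1 : ℚ) ^ j * n.choose j / n.factorial := fun j hj => by
    rw [Nat.cast_choose ℚ (Nat.lt_succ_iff.1 (mem_range.1 hj))]
    field_simp
  have hsum : (∑ j ∈ range (n + 1), (-1 : ℚ) ^ j * n.choose j) = 0 := by
    exact_mod_cast Int.alternating_sum_range_choose_of_ne hn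
  rw [eulerSum, sum_congr rfl hterm, ← sum_div, hsum, zero_div]

/-- At `j = 0` the truncated subtraction gives the intended value `1`. -/
theorem eulerSum_two_pow (l : ℕ) : eulerSum (fun j => 2 ^ (j - 1)) (2 * l + 2) = 0 := by
  have hterm : ∀ j ∈ range (2 * l + 1), (-1 : ℚ) ^ (j + 1) /
      ((2 ^ (j + 1 - 1) : ℕ) * (2 ^ (2 * l + 2 - (j + 1) - 1) : ℕ)) =
        -((-1) ^ j / 2 ^ (2 * l)) := fun j hj => by
    have hj := mem_range.1 hj
    rw [← Nat.cast_mul, ← pow_add,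
      show j + 1 - 1 + (2 * l + 2 - (j + 1) - 1) = 2 * l by omega, pow_succ]
    push_cast
    ring
  have heven : (-1 : ℚ) ^ (2 * l + 2) = 1 := Even.neg_one_pow ⟨l + 1, by ring⟩
  have hgeom : ∑ j ∈ range (2 * l + 1), (-1 : ℚ) ^ j = 1 := by
    rw [neg_one_geom_sum, if_neg (by simp)]
  rw [eulerSum, sum_range_succ, sum_range_succ', sum_congr rfl hterm, sum_neg_distrib,
    ← sum_div, hgeom, show 2 * l + 2 - 0 - 1 = 2 * l + 1 by omega]
  simp [heven]
  field_simp
  ring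

/-- In `eulerSum b n` with `n` even the outermost four terms contribute `2 / b n - 2 / b (n - 1)`,
so the Euler relation determines this difference from the smaller values of `b`. -/
theorem inv_sub_inv_eq_of_eulerSum_eq_zero (hf : eulerSum f (2 * l + 4) = 0)
    (hg : eulerSum g (2 * l + 4) = 0) (hf₀ : f 0 = 1) (hf₁ : f 1 = 1)
    (hfg : ∀ j ≤ 2 * l + 2, f j = g j) :
    (f (2 * l + 4) : ℚ)⁻¹ - (f (2 * l + 3) : ℚ)⁻¹ =
      (g (2 * l + 4) : ℚ)⁻¹ - (g (2 * l + 3) : ℚ)⁻¹ := by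
  have hsplit (h : ℕ → ℕ) (h₀ : h 0 = 1) (h₁ : h 1 = 1) : eulerSum h (2 * l + 4) =
      (∑ j ∈ range (2 * l + 1), (-1) ^ (j + 2) / (h (j + 2) * h (2 * l + 2 - j) : ℚ)) +
        2 * ((h (2 * l + 4) : ℚ)⁻¹ - (h (2 * l + 3) : ℚ)⁻¹) := by
    rw [eulerSum, show 2 * l + 4 + 1 = (2 * l + 1) + 1 + 1 + 1 + 1 by omega,
      sum_range_succ, sum_range_succ, sum_range_succ', sum_range_succ']
    have hsub (j : ℕ) : 2 * l + 4 - (j + 1 + 1) = 2 * l + 2 - j := by omega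
    have hodd : (-1 : ℚ) ^ (2 * l + 3) = -1 := Odd.neg_one_pow ⟨l + 1, by ring⟩
    have heven : (-1 : ℚ) ^ (2 * l + 4) = 1 := Even.neg_one_pow ⟨l + 2, by ring⟩
    simp [hsub, h₀, h₁, hodd, heven, add_assoc]
    ring
  have hinner : ∀ j ∈ range (2 * l + 1),
      (-1) ^ (j + 2) / (f (j + 2) * f (2 * l + 2 - j) : ℚ) =
        (-1) ^ (j + 2) / (g (j + 2) * g (2 * l + 2 - j) : ℚ) := fun j hj => by
    have hj := mem_range.1 hj
    rw [hfg (j + 2) (by omega), hfg (2 * l + 2 - j) (by omega)]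
  rw [hsplit f hf₀ hf₁, sum_congr rfl hinner] at hf
  rw [hsplit g (hfg 0 (by omega) ▸ hf₀) (hfg 1 (by omega) ▸ hf₁)] at hg
  linarith

theorem ratio_eq_of_eulerSum_eq_zero (hf : eulerSum f (2 * l + 4) = 0)
    (hg : eulerSum g (2 * l + 4) = 0) (hf₀ : f 0 = 1) (hf₁ : f 1 = 1)
    (hfg : ∀ j ≤ 2 * l + 2, f j = g j) (hpos : f (2 * l + 4) ≠ 0) (hgpos : g (2 * l + 4) ≠ 0)
    {c d γ δ : ℕ} (hc : f (2 * l + 3) = c * f (2 * l + 2))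
    (hd : f (2 * l + 4) = d * f (2 * l + 3)) (hγ : g (2 * l + 3) = γ * g (2 * l + 2))
    (hδ : g (2 * l + 4) = δ * g (2 * l + 3)) :
    d * γ * δ + c * d = δ * c * d + γ * δ := by
  have h := inv_sub_inv_eq_of_eulerSum_eq_zero hf hg hf₀ hf₁ hfg
  rw [hd, hc, hfg _ le_rfl, mul_ne_zero_iff, mul_ne_zero_iff] at hpos
  rw [hδ, hγ, mul_ne_zero_iff, mul_ne_zero_iff] at hgpos
  obtain ⟨hd₀, hc₀, hg₀⟩ := hpos
  obtain ⟨hδ₀, hγ₀, -⟩ := hgpos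
  rw [hd, hc, hδ, hγ, hfg _ le_rfl] at h
  push_cast at h
  field_simp at h
  have h' : (d * γ * δ + c * d : ℚ) = δ * c * d + γ * δ := by linarith
  exact_mod_cast h'

end EulerSum

namespace IsFactorialFunction

variable {P : Type*} [PartialOrder P] [GradeMinOrder ℕ P] [LocallyFiniteOrder P] {x y : P}
  {b : ℕ → ℕ}

theorem map_two (hb : IsFactorialFunction P b) (hE : IsEulerianPoset P)
    (hxy : IsIntervalOfRank 2 x y) : b 2 = 2 := by
  have hpos : (b 2 : ℚ) ≠ 0 := by exact_mod_cast (hb.pos hxy).ne'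
  have h := hb.eulerSum_eq_zero hE hxy two_ne_zero
  simp only [eulerSum, sum_range_succ, range_zero, sum_empty, hb.map_zero x,
    hb.map_one_of_pos hxy two_pos] at h
  norm_num at h
  field_simp at h
  have h' : (b 2 : ℚ) = 2 := by linarith
  exact_mod_cast h'

theorem ratio_ne_three (hb : IsFactorialFunction P b) {k : ℕ}
    (hxy : IsIntervalOfRank (k + 4) x y) (h₂ : b 2 = 2) (hk₂ : b (k + 2) = 2 * b (k + 1))
    (hk₃ : b (k + 3) = 2 * b (k + 2)) : b (k + 4) ≠ 3 * b (k + 3) := by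
  classical
  intro hk₄
  obtain ⟨w, hw⟩ := hb.intervalLevel_nonempty hxy (Nat.le_succ (k + 3))
  obtain ⟨hxw, hwy⟩ := mem_intervalLevel.1 hw
  have hcard_w := hb.card_intervalLevel_one hxw hk₃
  have hcard_y := hb.card_intervalLevel_one hxy hk₄
  obtain ⟨a, ha, haw⟩ := exists_mem_notMem_of_card_lt_card
    (show #(intervalLevel x w 1) < #(intervalLevel x y 1) by omega)
  have hrest : (intervalLevel x y 1).erase a = intervalLevel x w 1 :=
    (eq_of_subset_of_card_le (subset_erase.2 ⟨intervalLevel_subset hwy, haw⟩)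
      (by rw [card_erase_of_mem ha, hcard_w, hcard_y])).symm
  obtain ⟨hxa, -⟩ := mem_intervalLevel.1 ha
  have hay : IsIntervalOfRank (k + 3) a y := isIntervalOfRank_sub_of_mem_intervalLevel hxy ha
  obtain ⟨s, hs⟩ := hb.intervalLevel_nonempty hay (Nat.le_add_left 1 (k + 2))
  obtain ⟨has, hsy⟩ := mem_intervalLevel.1 hs
  have hxs : IsIntervalOfRank 2 x s := ⟨hxa.1.trans has.1, by rw [has.2, hxa.2]⟩
  have hcard_s : #(intervalLevel x s 1) = 2 :=
    hb.card_intervalLevel_one hxs (by rw [h₂, hb.map_one hxa])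
  obtain ⟨e, hes, hea⟩ := exists_mem_ne (hcard_s ▸ one_lt_two) a
  have hey : e ∈ intervalLevel x y 1 := intervalLevel_subset hsy hes
  have hew : e ∈ intervalLevel x w 1 := hrest ▸ mem_erase.2 ⟨hea, hey⟩
  -- Both `[e, w]` and `[e, y]` have two atoms, so the atom `s` of `[e, y]` lies below `w`.
  have hatoms : intervalLevel e w 1 = intervalLevel e y 1 :=
    eq_of_subset_of_card_le (intervalLevel_subset hwy) <| by
      rw [hb.card_intervalLevel_one (isIntervalOfRank_sub_of_mem_intervalLevel hxy hey) hk₃,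
        hb.card_intervalLevel_one (isIntervalOfRank_sub_of_mem_intervalLevel hxw hew) hk₂]
  have hsw : s ∈ intervalLevel e w 1 := hatoms ▸
    mem_intervalLevel.2 ⟨isIntervalOfRank_sub_of_mem_intervalLevel hxs hes, hsy⟩
  exact haw (mem_intervalLevel.2 ⟨hxa, has.1.trans (mem_intervalLevel.1 hsw).2⟩)

theorem ratio_eq_of_eq (hb : IsFactorialFunction P b) (hE : IsEulerianPoset P) {l : ℕ}
    (hxy : IsIntervalOfRank (2 * l + 4) x y) {g : ℕ → ℕ} (hbg : ∀ j ≤ 2 * l + 2, b j = g j)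
    (hg : eulerSum g (2 * l + 4) = 0) (hg_ne : g (2 * l + 4) ≠ 0) {c d γ δ : ℕ}
    (hc : b (2 * l + 3) = c * b (2 * l + 2)) (hd : b (2 * l + 4) = d * b (2 * l + 3))
    (hγ : g (2 * l + 3) = γ * g (2 * l + 2)) (hδ : g (2 * l + 4) = δ * g (2 * l + 3)) :
    d * γ * δ + c * d = δ * c * d + γ * δ :=
  ratio_eq_of_eulerSum_eq_zero (hb.eulerSum_eq_zero hE hxy (by omega)) hg (hb.map_zero x)
    (hb.map_one_of_pos hxy (by omega)) hbg (hb.pos hxy).ne' hg_ne hc hd hγ hδ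

theorem ratio_cases_of_eq_two_pow (hb : IsFactorialFunction P b) (hE : IsEulerianPoset P) {l : ℕ}
    (hxy : IsIntervalOfRank (2 * l + 4) x y) (hpow : ∀ j ≤ 2 * l + 2, b j = 2 ^ (j - 1)) {c d : ℕ}
    (hc : b (2 * l + 3) = c * b (2 * l + 2)) (hd : b (2 * l + 4) = d * b (2 * l + 3)) :
    c = 2 ∧ d = 2 ∨ c = 3 ∧ d = 4 := by
  have heq : d * 2 * 2 + c * d = 2 * c * d + 2 * 2 :=
    hb.ratio_eq_of_eq hE hxy hpow (eulerSum_two_pow (l + 1)) (by positivity) hc hd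
      (by rw [show 2 * l + 3 - 1 = 2 * l + 2 - 1 + 1 by omega, pow_succ'])
      (by rw [show 2 * l + 4 - 1 = 2 * l + 3 - 1 + 1 by omega, pow_succ'])
  have hc_pos : c ≠ 0 := by
    rintro rfl
    exact (hb.pos_of_le hxy (Nat.le_succ (2 * l + 3))).ne' (by rw [hc, zero_mul])
  have hc_lt : c < 4 := by nlinarith
  interval_cases c <;> omega

theorem ratio_eq_of_eq_factorial (hb : IsFactorialFunction P b) (hE : IsEulerianPoset P)
    (h₃ : b 3 = 6) {l : ℕ} (hxy : IsIntervalOfRank (2 * l + 4) x y)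
    (hfac : ∀ j ≤ 2 * l + 2, b j = j.factorial) {c d : ℕ}
    (hc : b (2 * l + 3) = c * b (2 * l + 2)) (hd : b (2 * l + 4) = d * b (2 * l + 3)) :
    c = 2 * l + 3 ∧ d = 2 * l + 4 := by
  have heq : d * (2 * l + 3) * (2 * l + 4) + c * d =
      (2 * l + 4) * c * d + (2 * l + 3) * (2 * l + 4) :=
    hb.ratio_eq_of_eq hE hxy hfac (eulerSum_factorial (by omega)) (Nat.factorial_ne_zero _) hc hd
      (Nat.factorial_succ _) (Nat.factorial_succ _)
  have hcancel : (2 * l + 4) * d = c * d + (2 * l + 4) :=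
    Nat.eq_of_mul_eq_mul_left (show 0 < 2 * l + 3 by omega) (by linarith)
  have hc_lt : c < 2 * l + 4 := by nlinarith
  have hcd : c ≤ d := hb.ratio_mono hxy hc hd
  have hc_ge : 2 * l + 2 ≤ c := by
    obtain ⟨z, hz⟩ := hb.intervalLevel_nonempty hxy (show 2 * l + 1 + 2 ≤ 2 * l + 4 by omega)
    refine hb.ratio_mono (mem_intervalLevel.1 hz).1 ?_ hc
    rw [hfac _ le_rfl, hfac _ (by omega)]
    rfl
  obtain rfl | rfl : c = 2 * l + 2 ∨ c = 2 * l + 3 := by omega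
  · have hl : l = 0 := by linarith
    subst hl
    have := hfac 2 le_rfl
    simp_all
  · exact ⟨rfl, by linarith⟩

theorem map_three (hb : IsFactorialFunction P b) (hE : IsEulerianPoset P)
    (hxy : IsIntervalOfRank 4 x y) : b 3 = 4 ∨ b 3 = 6 := by
  obtain ⟨z, hz⟩ := hb.intervalLevel_nonempty hxy (show 2 ≤ 4 by omega)
  have h₂ := hb.map_two hE (mem_intervalLevel.1 hz).1
  have hpow : ∀ j ≤ 2 * 0 + 2, b j = 2 ^ (j - 1) := fun j hj => by
    interval_cases j
    exacts [hb.map_zero x, hb.map_one_of_pos hxy four_pos, h₂]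
  obtain ⟨c, hc⟩ : ∃ c, b 3 = c * b 2 := hb.exists_ratio hxy (by omega)
  obtain ⟨d, hd⟩ : ∃ d, b 4 = d * b 3 := hb.exists_ratio hxy (by omega)
  have hcases := hb.ratio_cases_of_eq_two_pow hE hxy hpow hc hd
  rw [h₂] at hc
  omega

theorem eq_two_pow (hb : IsFactorialFunction P b) (hE : IsEulerianPoset P) (h₃ : b 3 = 4) {l : ℕ}
    (hxy : IsIntervalOfRank (2 * l + 2) x y) : ∀ j ≤ 2 * l + 2, b j = 2 ^ (j - 1) := by
  induction l generalizing y with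
  | zero =>
    intro j hj
    interval_cases j
    exacts [hb.map_zero x, hb.map_one_of_pos hxy two_pos, hb.map_two hE hxy]
  | succ l ih =>
    obtain ⟨z, hz⟩ := hb.intervalLevel_nonempty hxy (show 2 * l + 2 ≤ 2 * (l + 1) + 2 by omega)
    have hpow := ih (mem_intervalLevel.1 hz).1
    obtain ⟨c, hc⟩ := hb.exists_ratio hxy (show 2 * l + 2 < 2 * (l + 1) + 2 by omega)
    obtain ⟨d, hd⟩ := hb.exists_ratio hxy (show 2 * l + 3 < 2 * (l + 1) + 2 by omega)
    have hc_ne : c ≠ 3 := by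
      rintro rfl
      obtain _ | l := l
      · have h₂ : b 2 = 2 := hpow 2 le_rfl
        have h₃' : b 3 = 3 * b 2 := hc
        omega
      · obtain ⟨w, hw⟩ := hb.intervalLevel_nonempty hxy
          (show 2 * l + 1 + 4 ≤ 2 * (l + 1 + 1) + 2 by omega)
        exact hb.ratio_ne_three (mem_intervalLevel.1 hw).1 (hpow 2 (by omega))
          (by rw [hpow _ (by omega), hpow _ (by omega)]; exact pow_succ' 2 (2 * l + 1))
          (by rw [hpow _ (by omega), hpow _ (by omega)]; exact pow_succ' 2 (2 * l + 2)) hc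
    obtain ⟨rfl, rfl⟩ := (hb.ratio_cases_of_eq_two_pow hE hxy hpow hc hd).resolve_right
      fun h => hc_ne h.1
    intro j hj
    obtain hj | rfl | rfl : j ≤ 2 * l + 2 ∨ j = 2 * l + 3 ∨ j = 2 * l + 4 := by omega
    · exact hpow j hj
    · rw [hc, hpow _ le_rfl, ← pow_succ']
      rfl
    · rw [hd, hc, hpow _ le_rfl, ← pow_succ', ← pow_succ']
      rfl

theorem eq_factorial (hb : IsFactorialFunction P b) (hE : IsEulerianPoset P) (h₃ : b 3 = 6) {l : ℕ}
    (hxy : IsIntervalOfRank (2 * l + 2) x y) : ∀ j ≤ 2 * l + 2, b j = j.factorial := by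
  induction l generalizing y with
  | zero =>
    intro j hj
    interval_cases j
    exacts [hb.map_zero x, hb.map_one_of_pos hxy two_pos, hb.map_two hE hxy]
  | succ l ih =>
    obtain ⟨z, hz⟩ := hb.intervalLevel_nonempty hxy (show 2 * l + 2 ≤ 2 * (l + 1) + 2 by omega)
    have hfac := ih (mem_intervalLevel.1 hz).1
    obtain ⟨c, hc⟩ := hb.exists_ratio hxy (show 2 * l + 2 < 2 * (l + 1) + 2 by omega)
    obtain ⟨d, hd⟩ := hb.exists_ratio hxy (show 2 * l + 3 < 2 * (l + 1) + 2 by omega)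
    obtain ⟨rfl, rfl⟩ := hb.ratio_eq_of_eq_factorial hE h₃ hxy hfac hc hd
    intro j hj
    obtain hj | rfl | rfl : j ≤ 2 * l + 2 ∨ j = 2 * l + 3 ∨ j = 2 * l + 4 := by omega
    · exact hfac j hj
    · rw [hc, hfac _ le_rfl]
      rfl
    · rw [hd, hc, hfac _ le_rfl]
      rfl

end IsFactorialFunction

section Butterfly

theorem nonempty_orderIso_of_fiberEquiv {α β ι : Type*} [PartialOrder α] [PartialOrder β] [LT ι]
    {r : α → ι} {s : β → ι} (hr : ∀ a a', a < a' ↔ r a < r a') (hs : ∀ b b', b < b' ↔ s b < s b')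
    (e : ∀ i, {a // r a = i} ≃ {b // s b = i}) : Nonempty (α ≃o β) := by
  refine ⟨⟨Equiv.ofFiberEquiv e, fun {a a'} => ?_⟩⟩
  have hrank (a : α) : s (Equiv.ofFiberEquiv e a) = r a := Equiv.ofFiberEquiv_map e a
  rw [le_iff_lt_or_eq, le_iff_lt_or_eq, hs, hr, hrank, hrank,
    (Equiv.ofFiberEquiv e).injective.eq_iff]

theorem nonempty_orderIso_withBot_withTop_Ioo (α : Type*) [PartialOrder α] [BoundedOrder α]
    [Nontrivial α] : Nonempty (α ≃o WithBot (WithTop (Set.Ioo (⊥ : α) ⊤))) := by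
  classical
  let := Subtype.orderTop (α := α) (p := (· ≠ ⊥)) top_ne_bot
  let proper : {a : {a : α // a ≠ ⊥} // a ≠ ⊤} ≃o Set.Ioo (⊥ : α) ⊤ :=
    { toFun := fun a => ⟨a.1, bot_lt_iff_ne_bot.2 a.1.2,
        lt_top_iff_ne_top.2 fun h => a.2 (Subtype.ext h)⟩
      invFun := fun a => ⟨⟨a, a.2.1.ne'⟩, fun h => a.2.2.ne (Subtype.ext_iff.1 h)⟩
      map_rel_iff' := Iff.rfl }
  exact ⟨WithBot.subtypeOrderIso.symm.trans
    (WithTop.subtypeOrderIso.symm.trans proper.withTopCongr).withBotCongr⟩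

namespace ButterflyProper

variable {n : ℕ}

theorem lt_iff {p q : ButterflyProper n} : p < q ↔ p.level < q.level := by
  refine lt_iff_le_not_ge.trans ⟨?_, fun h => ⟨Or.inr h, ?_⟩⟩
  · rintro ⟨rfl | h, hqp⟩
    · exact absurd le_rfl hqp
    · exact h
  · rintro (rfl | h')
    · exact h.false
    · exact h.asymm h'

/-- The elements on a given level of the butterfly poset are told apart by their side. -/
def levelEquiv (i : Fin (n - 1)) : {p : ButterflyProper n // p.level = i} ≃ Fin 2 where
  toFun p := p.1.side
  invFun s := ⟨⟨i, s⟩, rfl⟩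
  left_inv := by rintro ⟨p, rfl⟩; rfl

end ButterflyProper

variable {P : Type*} [PartialOrder P] [GradeMinOrder ℕ P] [LocallyFiniteOrder P] {x y u v : P}
  {b : ℕ → ℕ} {j k : ℕ}

namespace IsFactorialFunction

theorem card_intervalLevel_eq_two (hb : IsFactorialFunction P b) (hxy : IsIntervalOfRank k x y)
    (hpow : ∀ j ≤ k, b j = 2 ^ (j - 1)) (hj : 0 < j) (hjk : j < k) :
    #(intervalLevel x y j) = 2 := by
  have h := hb.card_intervalLevel_mul hxy hjk.le
  rw [hpow j hjk.le, hpow _ (k.sub_le j), hpow k le_rfl, ← pow_add,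
    show k - 1 = (j - 1 + (k - j - 1)) + 1 by omega, pow_succ'] at h
  exact Nat.eq_of_mul_eq_mul_right (by positivity) h

theorem lt_of_grade_lt (hb : IsFactorialFunction P b) (hxy : IsIntervalOfRank k x y)
    (hpow : ∀ j ≤ k, b j = 2 ^ (j - 1)) (hu : u ∈ Set.Ioo x y) (hv : v ∈ Set.Ioo x y)
    (huv : grade ℕ u < grade ℕ v) : u < v := by
  obtain ⟨i, hui⟩ := exists_mem_intervalLevel (Set.Ioo_subset_Icc_self hu)
  obtain ⟨j, hvj⟩ := exists_mem_intervalLevel (Set.Ioo_subset_Icc_self hv)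
  have hgu := (mem_intervalLevel.1 hui).1.2
  have hgv := (mem_intervalLevel.1 hvj).1.2
  have hjk : j < k := by
    have := grade_strictMono (𝕆 := ℕ) hv.2
    have := hxy.2
    omega
  have hi : 0 < i := by
    have := grade_strictMono (𝕆 := ℕ) hu.1
    omega
  have hsub : intervalLevel u y (j - i) ⊆ intervalLevel x y j := fun w hw => by
    obtain ⟨⟨huw, hgw⟩, hwy⟩ := mem_intervalLevel.1 hw
    exact mem_intervalLevel.2 ⟨⟨hu.1.le.trans huw, by omega⟩, hwy⟩
  have huy : IsIntervalOfRank (k - i) u y := isIntervalOfRank_sub_of_mem_intervalLevel hxy hui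
  have hlevel : intervalLevel u y (j - i) = intervalLevel x y j :=
    eq_of_subset_of_card_le hsub <| by
      rw [hb.card_intervalLevel_eq_two hxy hpow (by omega) hjk,
        hb.card_intervalLevel_eq_two huy (fun m hm => hpow m (hm.trans (k.sub_le i))) (by omega)
          (by omega)]
  have huv' : u ≤ v := (mem_intervalLevel.1 (hlevel ▸ hvj)).1.1
  exact huv'.lt_of_ne fun h => huv.ne (congrArg (grade ℕ) h)

theorem nonempty_orderIso_butterflyPoset [BoundedOrder P] (hb : IsFactorialFunction P b)
    (hn : IsIntervalOfRank k (⊥ : P) ⊤) (hk : k ≠ 0) (hpow : ∀ j ≤ k, b j = 2 ^ (j - 1)) :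
    Nonempty (P ≃o ButterflyPoset k) := by
  have hn_top : grade ℕ (⊤ : P) = k := by simpa using hn.2
  have : Nontrivial P := ⟨⊥, ⊤, fun h => hk (by rw [← hn_top, ← h, grade_bot, Nat.bot_eq_zero])⟩
  have hgrade (p : Set.Ioo (⊥ : P) ⊤) : 0 < grade ℕ p.1 ∧ grade ℕ p.1 < k :=
    ⟨by simpa using grade_strictMono (𝕆 := ℕ) p.2.1, hn_top ▸ grade_strictMono p.2.2⟩
  let level (p : Set.Ioo (⊥ : P) ⊤) : Fin (k - 1) :=
    ⟨grade ℕ p.1 - 1, Nat.sub_lt_sub_right (hgrade p).1 (hgrade p).2⟩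
  have hlevel (p : Set.Ioo (⊥ : P) ⊤) : grade ℕ p.1 = level p + 1 :=
    (Nat.sub_add_cancel (hgrade p).1).symm
  have hlt (p q : Set.Ioo (⊥ : P) ⊤) : p < q ↔ level p < level q := by
    rw [Fin.lt_def, ← Nat.succ_lt_succ_iff, Nat.succ_eq_add_one, Nat.succ_eq_add_one, ← hlevel,
      ← hlevel]
    exact ⟨fun h => grade_strictMono h, hb.lt_of_grade_lt hn hpow p.2 q.2⟩
  have hmem (i : Fin (k - 1)) (p : Set.Ioo (⊥ : P) ⊤) :
      level p = i ↔ p.1 ∈ intervalLevel ⊥ ⊤ (i + 1) := by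
    rw [Fin.ext_iff, ← Nat.succ_inj, Nat.succ_eq_add_one, ← hlevel]
    simp [mem_intervalLevel, IsIntervalOfRank]
  obtain ⟨e⟩ := nonempty_orderIso_of_fiberEquiv hlt (fun _ _ => ButterflyProper.lt_iff) fun i =>
    calc {p // level p = i}
      _ ≃ {p : Set.Ioo (⊥ : P) ⊤ // p.1 ∈ intervalLevel ⊥ ⊤ (i + 1)} :=
        Equiv.subtypeEquivRight (hmem i)
      _ ≃ intervalLevel (⊥ : P) ⊤ (i + 1) := Equiv.subtypeSubtypeEquivSubtype fun hz =>
        mem_Ioo_of_mem_intervalLevel hn hz i.val.succ_pos (by omega)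
      _ ≃ Fin 2 := Finset.equivFinOfCardEq <|
        hb.card_intervalLevel_eq_two hn hpow i.val.succ_pos (by omega)
      _ ≃ {q : ButterflyProper k // q.level = i} := (ButterflyProper.levelEquiv i).symm
  obtain ⟨e'⟩ := nonempty_orderIso_withBot_withTop_Ioo P
  exact ⟨e'.trans e.withTopCongr.withBotCongr⟩

end IsFactorialFunction

end Butterfly

section Boolean

variable {P : Type*} [PartialOrder P] [GradeMinOrder ℕ P] [LocallyFiniteOrder P]
  {x y u v a a' c : P} {b : ℕ → ℕ} {j k : ℕ}

namespace IsFactorialFunction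

theorem card_intervalLevel_eq_choose (hb : IsFactorialFunction P b) (hxy : IsIntervalOfRank k x y)
    (hfac : ∀ j ≤ k, b j = j.factorial) (j : ℕ) : #(intervalLevel x y j) = k.choose j := by
  rcases le_or_gt j k with hj | hj
  · have h := hb.card_intervalLevel_mul hxy hj
    rw [hfac j hj, hfac _ (k.sub_le j), hfac k le_rfl, ← Nat.choose_mul_factorial_mul_factorial hj,
      mul_assoc] at h
    exact Nat.eq_of_mul_eq_mul_right (by positivity) h
  · rw [Nat.choose_eq_zero_of_lt hj, card_eq_zero, eq_empty_iff_forall_notMem]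
    exact fun z hz => hj.not_ge (le_of_mem_intervalLevel hxy hz)

theorem card_atoms (hb : IsFactorialFunction P b) (hxy : IsIntervalOfRank k x y)
    (hfac : ∀ j ≤ k, b j = j.factorial) : #(intervalLevel x y 1) = k := by
  rw [hb.card_intervalLevel_eq_choose hxy hfac, Nat.choose_one_right]

theorem card_coatoms (hb : IsFactorialFunction P b) (hxy : IsIntervalOfRank (k + 1) x y)
    (hfac : ∀ j ≤ k + 1, b j = j.factorial) : #(intervalLevel x y k) = k + 1 := by
  rw [hb.card_intervalLevel_eq_choose hxy hfac, Nat.choose_succ_self_right]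

theorem card_coatoms_ge [DecidableLE P] (hb : IsFactorialFunction P b)
    (hxy : IsIntervalOfRank (k + 1) x y) (hfac : ∀ j ≤ k + 1, b j = j.factorial)
    (hu : u ∈ intervalLevel x y j) : #{c ∈ intervalLevel x y k | u ≤ c} = k + 1 - j := by
  have huy := isIntervalOfRank_sub_of_mem_intervalLevel hxy hu
  obtain ⟨hxu, hgu⟩ := (mem_intervalLevel.1 hu).1
  rcases (le_of_mem_intervalLevel hxy hu).lt_or_eq with hj | rfl
  · rw [show k + 1 - j = k - j + 1 by omega] at huy ⊢
    rw [← hb.card_coatoms huy fun i hi => hfac i (by omega)]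
    congr 1
    ext c
    simp only [mem_filter, mem_intervalLevel, IsIntervalOfRank]
    constructor
    · rintro ⟨⟨⟨-, hgc⟩, hcy⟩, huc⟩
      exact ⟨⟨huc, by omega⟩, hcy⟩
    · rintro ⟨⟨huc, hgc⟩, hcy⟩
      exact ⟨⟨⟨hxu.trans huc, by omega⟩, hcy⟩, huc⟩
  · rw [Nat.sub_self, card_eq_zero, filter_eq_empty_iff]
    intro c hc huc
    have := grade_mono (𝕆 := ℕ) huc
    have := (mem_intervalLevel.1 hc).1.2
    omega

theorem exists_coatom_not_ge (hb : IsFactorialFunction P b) (hxy : IsIntervalOfRank (k + 1) x y)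
    (hfac : ∀ j ≤ k + 1, b j = j.factorial) (ha : a ∈ intervalLevel x y 1) :
    ∃ c ∈ intervalLevel x y k, ¬a ≤ c := by
  classical
  by_contra! hall
  have h := hb.card_coatoms_ge hxy hfac ha
  rw [filter_true_of_mem hall, hb.card_coatoms hxy hfac] at h
  omega

theorem eq_of_not_le_coatom (hb : IsFactorialFunction P b) (hxy : IsIntervalOfRank (k + 1) x y)
    (hfac : ∀ j ≤ k + 1, b j = j.factorial) (hc : c ∈ intervalLevel x y k)
    (ha : a ∈ intervalLevel x y 1) (ha' : a' ∈ intervalLevel x y 1) (hac : ¬a ≤ c)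
    (hac' : ¬a' ≤ c) : a = a' := by
  classical
  obtain ⟨hxc, hcy⟩ := mem_intervalLevel.1 hc
  have hcard : #(intervalLevel x y 1 \ intervalLevel x c 1) ≤ 1 := by
    rw [card_sdiff_of_subset (intervalLevel_subset hcy), hb.card_atoms hxy hfac,
      hb.card_atoms hxc fun j hj => hfac j (by omega), Nat.add_sub_cancel_left]
  have hmem {d : P} (hd : d ∈ intervalLevel x y 1) (hdc : ¬d ≤ c) :
      d ∈ intervalLevel x y 1 \ intervalLevel x c 1 :=
    mem_sdiff.2 ⟨hd, fun h => hdc (mem_intervalLevel.1 h).2⟩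
  exact card_le_one.1 hcard a (hmem ha hac) a' (hmem ha' hac')

theorem le_coatom_of_intervalLevel_one_subset (hb : IsFactorialFunction P b)
    (hxy : IsIntervalOfRank (k + 1) x y) (hfac : ∀ j ≤ k + 1, b j = j.factorial)
    (hu : u ∈ Set.Icc x y) (hc : c ∈ intervalLevel x y k)
    (huc : intervalLevel x u 1 ⊆ intervalLevel x c 1) : u ≤ c := by
  classical
  -- Distinct atoms below `u` are missed by distinct coatoms, which leaves no more coatoms above all
  -- of these atoms than there are above `u` itself.
  obtain ⟨r, hur⟩ := exists_mem_intervalLevel hu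
  have hr := le_of_mem_intervalLevel hxy hur
  let above : Finset P := {c ∈ intervalLevel x y k | u ≤ c}
  let aboveAtoms : Finset P := {c ∈ intervalLevel x y k | intervalLevel x u 1 ⊆ intervalLevel x c 1}
  have hsub : above ⊆ aboveAtoms :=
    monotone_filter_right _ fun c _ huc => intervalLevel_subset huc
  choose! f hf hf_not using fun a (ha : a ∈ intervalLevel x u 1) =>
    hb.exists_coatom_not_ge hxy hfac (intervalLevel_subset hu.2 ha)
  have hmaps : ∀ a ∈ intervalLevel x u 1, f a ∈ intervalLevel x y k \ aboveAtoms := fun a ha =>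
    mem_sdiff.2 ⟨hf a ha, fun h => hf_not a ha (mem_intervalLevel.1 ((mem_filter.1 h).2 ha)).2⟩
  have hinj : Set.InjOn f (intervalLevel x u 1) := fun a ha a' ha' h =>
    hb.eq_of_not_le_coatom hxy hfac (hf a ha) (intervalLevel_subset hu.2 ha)
      (intervalLevel_subset hu.2 ha') (hf_not a ha) (h ▸ hf_not a' ha')
  have hcard : #aboveAtoms ≤ #above := by
    have hle : r ≤ #(intervalLevel x y k \ aboveAtoms) :=
      hb.card_atoms (mem_intervalLevel.1 hur).1 (fun j hj => hfac j (hj.trans hr)) ▸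
        card_le_card_of_injOn f hmaps hinj
    have hsplit : #(intervalLevel x y k \ aboveAtoms) + #aboveAtoms = k + 1 :=
      hb.card_coatoms hxy hfac ▸ card_sdiff_add_card_eq_card (filter_subset _ _)
    have habove : #above = k + 1 - r := hb.card_coatoms_ge hxy hfac hur
    omega
  have hc_mem : c ∈ above := eq_of_subset_of_card_le hsub hcard ▸ mem_filter.2 ⟨hc, huc⟩
  exact (mem_filter.1 hc_mem).2

theorem le_of_intervalLevel_one_subset (hb : IsFactorialFunction P b)
    (hxy : IsIntervalOfRank k x y) (hfac : ∀ j ≤ k, b j = j.factorial)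
    (hu : u ∈ Set.Icc x y) (hv : v ∈ Set.Icc x y)
    (huv : intervalLevel x u 1 ⊆ intervalLevel x v 1) : u ≤ v := by
  induction k generalizing y with
  | zero =>
    have hyx : y = x := (eq_of_le_of_grade_le hxy.1 hxy.2.le).symm
    exact (hyx ▸ hu.2).trans hv.1
  | succ k ih =>
    rcases hv.2.eq_or_lt with rfl | hvy
    · exact hu.2
    obtain ⟨c, hc, hvc⟩ : ∃ c ∈ intervalLevel x y k, v ≤ c := by
      classical
      obtain ⟨j, hvj⟩ := exists_mem_intervalLevel hv
      have hj : 0 < k + 1 - j := by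
        have := grade_strictMono (𝕆 := ℕ) hvy
        have := hxy.2
        have := (mem_intervalLevel.1 hvj).1.2
        omega
      obtain ⟨c, hc⟩ := card_pos.1 (hb.card_coatoms_ge hxy hfac hvj ▸ hj)
      exact ⟨c, mem_filter.1 hc⟩
    have huc := hb.le_coatom_of_intervalLevel_one_subset hxy hfac hu hc
      (huv.trans (intervalLevel_subset hvc))
    exact ih (mem_intervalLevel.1 hc).1 (fun j hj => hfac j (hj.trans k.le_succ)) ⟨hu.1, huc⟩
      ⟨hv.1, hvc⟩

theorem card_Icc_eq_two_pow (hb : IsFactorialFunction P b) (hxy : IsIntervalOfRank k x y)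
    (hfac : ∀ j ≤ k, b j = j.factorial) : #(Finset.Icc x y) = 2 ^ k := by
  rw [card_eq_sum_ones, sum_Icc_eq_sum_intervalLevel hxy, ← Nat.sum_range_choose]
  refine sum_congr rfl fun j _ => ?_
  rw [← card_eq_sum_ones, hb.card_intervalLevel_eq_choose hxy hfac]

theorem nonempty_orderIso_booleanLattice [BoundedOrder P] (hb : IsFactorialFunction P b)
    (hn : IsIntervalOfRank k (⊥ : P) ⊤) (hfac : ∀ j ≤ k, b j = j.factorial) :
    Nonempty (P ≃o BooleanLattice k) := by
  classical
  let e : Fin k ≃ intervalLevel (⊥ : P) ⊤ 1 := (equivFinOfCardEq (hb.card_atoms hn hfac)).symm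
  let f : P ↪o BooleanLattice k := OrderEmbedding.ofMapLEIff
    (fun u => univ.filter fun i => (e i : P) ≤ u) fun u v => by
      refine ⟨fun h => ?_, fun huv => monotone_filter_right _ fun i _ hi => hi.trans huv⟩
      refine hb.le_of_intervalLevel_one_subset hn hfac ⟨bot_le, le_top⟩ ⟨bot_le, le_top⟩
        fun a ha => ?_
      obtain ⟨hxa, hau⟩ := mem_intervalLevel.1 ha
      have hi := h (mem_filter.2 ⟨mem_univ (e.symm ⟨a, intervalLevel_subset le_top ha⟩), by simpa⟩)
      exact mem_intervalLevel.2 ⟨hxa, by simpa using hi⟩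
  have hsurj : Set.SurjOn f (Finset.Icc (⊥ : P) ⊤) (univ : Finset (BooleanLattice k)) :=
    surjOn_of_injOn_of_card_le f (fun _ _ => mem_univ _)
      f.injective.injOn <| by
        rw [hb.card_Icc_eq_two_pow hn hfac, card_univ, Fintype.card_finset, Fintype.card_fin]
  exact ⟨RelIso.ofSurjective f fun s => (hsurj (mem_univ s)).imp fun _ h => h.2⟩

end IsFactorialFunction

end Boolean

theorem theorem3p6 {P : Type*} [PartialOrder P] [BoundedOrder P] [Finite P] [GradeMinOrder ℕ P]
    (hB : IsBinomialPoset P) (hE : IsEulerianPoset P)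
    (n m : ℕ) (hnm : n = 2 * m) (hn : 4 ≤ n) (hrank : grade ℕ (⊤ : P) = n) :
    Nonempty (P ≃o ButterflyPoset n) ∨ Nonempty (P ≃o BooleanLattice n) := by
  classical
  let := LocallyFiniteOrder.ofFiniteIcc fun x y : P => Set.toFinite (Set.Icc x y)
  obtain ⟨b, hb⟩ := hB.exists_isFactorialFunction
  have hP : IsIntervalOfRank n (⊥ : P) ⊤ := ⟨bot_le, by simpa using hrank⟩
  obtain ⟨l, rfl⟩ : ∃ l, n = 2 * l + 2 := ⟨m - 1, by omega⟩
  obtain ⟨z, hz⟩ := hb.intervalLevel_nonempty hP hn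
  rcases hb.map_three hE (mem_intervalLevel.1 hz).1 with h₃ | h₃
  · exact Or.inl (hb.nonempty_orderIso_butterflyPoset hP (by omega) (hb.eq_two_pow hE h₃ hP))
  · exact Or.inr (hb.nonempty_orderIso_booleanLattice hP (hb.eq_factorial hE h₃ hP))
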